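/- For a tuple $\underline{x}=(x_1,\dots,x_n)$ of nonnegative real numbers and an integer $1\le k\le n$, let $$\mathsf{sym}_k(\underline{x})=\left(\binom{n}{k}^{-1}\sum_{i_1<\cdots<i_k}x_{i_1}\cdots x_{i_k}\right)^{1/k}$$ be the $k$-th symmetric mean. For $c\in(0,1]$ let $\mathsf{hsm}_c(\underline{x})$ be the Halász–Székely mean of $\underline{x}$ with parameter $c$, that is, the Halász–Székely barycenter of the probability measure $\mu=\frac1n(\delta_{x_1}+\dots+\delta_{x_n})$: $$\mathsf{hsm}_c(\underline{x})=\exp\,\inf_{y>0}\int K(x,y,c)\,d\mu(x)=\exp\,\inf_{y>0}\frac1n\sum_{i=1}^n K(x_i,y,c),\qquad K(x,y,c)=\log y+c^{-1}\log\left(cy^{-1}x+1-c\right),$$ with the conventions $\log 0=-\infty$ and $\exp(-\infty)=0$. Put $B(c)=c(1-c)^{(1-c)/c}$ for $0<c<1$ and $B(1)=1$. **Theorem.** Let $\underline{x}=(x_1,\dots,x_n)$ with $x_i\ge 0$, and let $1\le k\le n$. Then $$\mathsf{hsm}_{k/n}(\underline{x})\ \le\ \mathsf{sym}_k(\underline{x})\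 \le\ \frac{\binom{n}{k}^{-1/k}}{B\left(\frac kn\right)}\,\mathsf{hsm}_{k/n}(\underline{x}).$$ Suppose moreover that $x_1\ge x_2\ge\cdots\ge x_n$. Then the second inequality is an equality if and only if $k=n$ or $x_{k+1}=0$ (the latter for $k<n$), and the first inequality is an equality if and only if $k=n$, or $x_1=\cdots=x_n$, or $x_k=0$. -/

import Mathlib

open MeasureTheory
open scoped NNReal ENNReal

noncomputable section

namespace HalaszSzekely

/-- The Halász–Székely kernel `K(x, y, c)` for `x ≥ 0`, `y > 0` and `c ∈ [0, 1]`, with values in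
the extended line: `log y + c⁻¹ log (c y⁻¹ x + 1 - c)` if `c > 0` and `log y + y⁻¹ x - 1` if
`c = 0`. Here `ENNReal.log` is the extended logarithm, with `log 0 = -∞`; its argument is
nonnegative for the `x, y, c` in question, so `ENNReal.ofReal` does not change it. -/
def kernel (x : ℝ≥0) (y c : ℝ) : EReal :=
  if 0 < c then
    (Real.log y : EReal) +
      ((c⁻¹ : ℝ) : EReal) * ENNReal.log (ENNReal.ofReal (c * y⁻¹ * (x : ℝ) + 1 - c))
  else
    ((Real.log y + y⁻¹ * (x : ℝ) - 1 : ℝ) : EReal)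

/-- The integral of a semi-integrable function with values in the extended line: the integral
of the positive part minus the integral of the negative part. -/
def extIntegral {α : Type*} [MeasurableSpace α] (μ : Measure α) (f : α → EReal) : EReal :=
  ((∫⁻ a, (f a).toENNReal ∂μ : ℝ≥0∞) : EReal) - ((∫⁻ a, (-f a).toENNReal ∂μ : ℝ≥0∞) : EReal)

/-- The Halász–Székely barycenter `[μ]_c = exp (inf_{y > 0} ∫ K(x, y, c) dμ(x))`, an element of
`[0, ∞]`, of a Borel probability measure `μ` on `[0, ∞)` and `c ∈ [0, 1]` (for `c = 1` with
`log` semi-integrable with respect to `μ`, as is the case for finitely supported `μ`). -/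
def barycenter (c : ℝ) (μ : Measure ℝ≥0) : ℝ≥0∞ :=
  EReal.exp (⨅ (y : ℝ) (_ : 0 < y), extIntegral μ fun x => kernel x y c)

/-- The probability measure `(δ_{x_1} + ⋯ + δ_{x_n}) / n` of a tuple (`n ≥ 1`). -/
def empirical {n : ℕ} (x : Fin n → ℝ≥0) : Measure ℝ≥0 :=
  (n : ℝ≥0∞)⁻¹ • ∑ i, Measure.dirac (x i)

/-- The Halász–Székely mean with parameter `c` of a tuple of nonnegative numbers. -/
def hsm {n : ℕ} (c : ℝ) (x : Fin n → ℝ≥0) : ℝ≥0∞ :=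
  barycenter c (empirical x)

/-- The `k`-th symmetric mean `(E_k(x) / (n choose k)) ^ (1 / k)` for `1 ≤ k ≤ n`, where `E_k` is
the elementary symmetric polynomial of degree `k` in `n` variables. -/
def sym {n : ℕ} (k : ℕ) (x : Fin n → ℝ≥0) : ℝ≥0 :=
  (MvPolynomial.eval x (MvPolynomial.esymm (Fin n) ℝ≥0 k) / (n.choose k : ℝ≥0)) ^ (1 / (k : ℝ))

/-- The function `B` on `[0, 1]`: `B(0) = 0`, `B(1) = 1` and `B(c) = c (1 - c) ^ ((1 - c) / c)`
for `0 < c < 1`. -/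
def B (c : ℝ) : ℝ :=
  if c = 0 then 0 else if c = 1 then 1 else c * (1 - c) ^ ((1 - c) / c)

end HalaszSzekely

end

/-!
Write `E j` for the elementary symmetric functions of `x` and `p j = E j / (n choose j)` for their
means. With `c = k / n`, exponentiating the integral of the kernel turns the `k`-th power of the
Halász–Székely mean into the infimum over `y > 0` of the profile
`y ^ k * ∏ i, (c * x i / y + 1 - c) = ∑ j, w j * p j * y ^ (k - j)`, where `w` is the binomial
distribution with parameters `n` and `c` (`hsm_eq_iInf_profile`, `profile_eq_sum`). The `k`-th power
of the symmetric mean is `p k`, and the constant of the upper bound is `w k ^ (-1 / k)`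
(`choose_rpow_div_B`).

Upper bound: the profile is at least its term `w k * p k`. If `p (k + 1) = 0`, no negative powers of
`y` occur and this value is the limit as `y → 0`; otherwise the two neighbouring terms are nonzero
and add up to something bounded away from zero.

Lower bound: if `p k = 0`, both means vanish, by the limit `y → 0`. Let `p k > 0`. By Newton's
inequality (`Multiset.esymmMean_mul_le_sq`) the sequence `p` is log-concave, hence lies
below the geometric sequence through `p (k - 1)` and `p k`
(`Multiset.esymmMean_div_pow_le`). For `y` equal to its ratio `p k / p (k - 1)` every
`p j * y ^ (k - j)` is at most `p k`, and so is their average with weights `w`. Newton's inequality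
is strict at `k` unless all entries agree (`Multiset.esymmMean_mul_lt_sq`), so for `k < n` the term
with index `k + 1` makes this strict. For equal entries, equality is the
arithmetic-geometric mean inequality.

Newton's inequality is proved by adding one entry at a time.
-/

/-! ### Newton's inequality for the means of elementary symmetric functions -/

namespace Multiset

/-- The mean of the products of `j` entries of `s` at distinct places: the `j`-th elementary
symmetric function divided by its number of terms. For `j > card s` it is `0 / 0 = 0`. -/
noncomputable def esymmMean (s : Multiset ℝ) (j : ℕ) : ℝ :=
  s.esymm j / (s.card.choose j : ℝ)

lemma esymm_eq_zero_of_card_lt {R : Type*} [CommSemiring R] {s : Multiset R} {j : ℕ}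
    (h : s.card < j) : s.esymm j = 0 := by
  simp [esymm, powersetCard_eq_empty j h]

lemma esymm_cons_succ {R : Type*} [CommSemiring R] (x : R) (s : Multiset R) (j : ℕ) :
    (x ::ₘ s).esymm (j + 1) = s.esymm (j + 1) + x * s.esymm j := by
  simp [esymm, powersetCard_cons, Multiset.map_map, sum_map_mul_left]

lemma esymm_nonneg {s : Multiset ℝ} (hs : ∀ a ∈ s, 0 ≤ a) (j : ℕ) : 0 ≤ s.esymm j := by
  refine Multiset.sum_nonneg fun a ha => ?_
  obtain ⟨t, ht, rfl⟩ := Multiset.mem_map.1 ha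
  exact Multiset.prod_nonneg fun a ha =>
    hs a (Multiset.mem_of_le (Multiset.mem_powersetCard.1 ht).1 ha)

lemma prod_map_mul_add_eq_sum_esymm {R : Type*} [CommSemiring R] (s : Multiset R) (α β : R) :
    (s.map fun a => α * a + β).prod
      = ∑ j ∈ Finset.range (s.card + 1), s.esymm j * α ^ j * β ^ (s.card - j) := by
  induction s using Multiset.induction with
  | empty => simp [esymm]
  | cons x s ih =>
    rw [Multiset.map_cons, Multiset.prod_cons, ih, card_cons, Finset.sum_range_succ' _ (s.card + 1)]
    simp only [esymm_cons_succ, add_mul, Finset.sum_add_distrib, Nat.add_sub_add_right]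
    rw [Finset.sum_range_succ (fun j => s.esymm (j + 1) * α ^ (j + 1) * β ^ (s.card - j)),
      esymm_eq_zero_of_card_lt (Nat.lt_succ_self s.card), Finset.mul_sum, Finset.mul_sum,
      Finset.sum_range_succ' (fun j => β * (s.esymm j * α ^ j * β ^ (s.card - j)))]
    have h1 : ∀ j ∈ Finset.range s.card,
        β * (s.esymm (j + 1) * α ^ (j + 1) * β ^ (s.card - (j + 1)))
          = s.esymm (j + 1) * α ^ (j + 1) * β ^ (s.card - j) := by
      intro j hj
      have : s.card - j = s.card - (j + 1) + 1 := by
        have := Finset.mem_range.1 hj; omega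
      rw [this]; ring
    have h0 : (x ::ₘ s).esymm 0 = 1 := by simp [esymm]
    have h0' : s.esymm 0 = 1 := by simp [esymm]
    rw [Finset.sum_congr rfl h1, h0, h0']
    have h2 : ∀ j, α * x * (s.esymm j * α ^ j * β ^ (s.card - j))
        = x * s.esymm j * α ^ (j + 1) * β ^ (s.card - j) := by intro j; ring
    simp only [h2, Nat.sub_zero, pow_succ]
    ring

lemma esymmMean_zero (s : Multiset ℝ) : s.esymmMean 0 = 1 := by simp [esymmMean, esymm]

lemma esymmMean_of_card_lt {s : Multiset ℝ} {j : ℕ} (h : s.card < j) : s.esymmMean j = 0 := by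
  simp [esymmMean, esymm_eq_zero_of_card_lt h]

lemma esymmMean_nonneg {s : Multiset ℝ} (hs : ∀ a ∈ s, 0 ≤ a) (j : ℕ) : 0 ≤ s.esymmMean j :=
  div_nonneg (esymm_nonneg hs j) (Nat.cast_nonneg _)

lemma choose_mul_esymmMean (s : Multiset ℝ) (j : ℕ) :
    (s.card.choose j : ℝ) * s.esymmMean j = s.esymm j := by
  rcases le_or_gt j s.card with h | h
  · have : (s.card.choose j : ℝ) ≠ 0 := by exact_mod_cast (Nat.choose_pos h).ne'
    rw [esymmMean]; field_simp
  · simp [esymmMean_of_card_lt h, esymm_eq_zero_of_card_lt h]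

lemma esymmMean_cons_succ (x : ℝ) (s : Multiset ℝ) (j : ℕ) :
    ((s.card : ℝ) + 1) * (x ::ₘ s).esymmMean (j + 1)
      = ((s.card : ℝ) - j) * s.esymmMean (j + 1) + (j + 1) * x * s.esymmMean j := by
  rcases le_or_gt j s.card with h | h
  · have e1 : ((s.card : ℝ) + 1) * (s.card.choose j)
        = ((s.card + 1).choose (j + 1) : ℝ) * (j + 1) := by
      exact_mod_cast Nat.add_one_mul_choose_eq s.card j
    have e2 : (s.card.choose (j + 1) : ℝ) * (j + 1) = s.card.choose j * ((s.card : ℝ) - j) := by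
      rw [← Nat.cast_sub h]
      exact_mod_cast Nat.choose_succ_right_eq s.card j
    have e3 := choose_mul_esymmMean (x ::ₘ s) (j + 1)
    rw [card_cons, esymm_cons_succ, ← choose_mul_esymmMean s, ← choose_mul_esymmMean s] at e3
    have hc : (s.card.choose j : ℝ) ≠ 0 := by exact_mod_cast (Nat.choose_pos h).ne'
    apply mul_left_cancel₀ hc
    linear_combination (x ::ₘ s).esymmMean (j + 1) * e1 + (j + 1 : ℝ) * e3
      + s.esymmMean (j + 1) * e2
  · rw [esymmMean_of_card_lt (s := x ::ₘ s) (by rw [card_cons]; omega), esymmMean_of_card_lt h,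
      esymmMean_of_card_lt (h.trans (Nat.lt_succ_self j))]
    ring

/-- The sequence of means has no internal zeros: after a zero it vanishes. -/
lemma esymmMean_succ_eq_zero {s : Multiset ℝ} (hs : ∀ a ∈ s, 0 ≤ a) {j : ℕ}
    (h : s.esymmMean j = 0) : s.esymmMean (j + 1) = 0 := by
  induction s using Multiset.induction generalizing j with
  | empty => exact esymmMean_of_card_lt (by simp)
  | cons x s ih =>
    have hx : 0 ≤ x := hs x (mem_cons_self x s)
    have hs' : ∀ a ∈ s, 0 ≤ a := fun a ha => hs a (mem_cons_of_mem ha)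
    rcases j with _ | j
    · simp [esymmMean_zero] at h
    rcases lt_or_ge j s.card with hj | hj
    · have e := esymmMean_cons_succ x s j
      have e' := esymmMean_cons_succ x s (j + 1)
      have hj' : (0 : ℝ) < (s.card : ℝ) - j := by
        rw [sub_pos]; exact_mod_cast hj
      have h1 : 0 ≤ ((s.card : ℝ) - j) * s.esymmMean (j + 1) :=
        mul_nonneg hj'.le (esymmMean_nonneg hs' _)
      have h2 : 0 ≤ (j + 1) * x * s.esymmMean j :=
        mul_nonneg (by positivity) (esymmMean_nonneg hs' _)
      rw [h, mul_zero] at e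
      have h3 : s.esymmMean (j + 1) = 0 :=
        (mul_eq_zero.1 (by linarith)).resolve_left hj'.ne'
      rw [h3, ih hs' h3, mul_zero, mul_zero, add_zero] at e'
      exact (mul_eq_zero.1 e').resolve_left (by positivity)
    · exact esymmMean_of_card_lt (by rw [card_cons]; omega)

lemma esymmMean_eq_zero_of_le {s : Multiset ℝ} (hs : ∀ a ∈ s, 0 ≤ a) {i j : ℕ} (hij : i ≤ j)
    (h : s.esymmMean i = 0) : s.esymmMean j = 0 := by
  induction j, hij using Nat.le_induction with
  | base => exact h
  | succ j _ ih => exact esymmMean_succ_eq_zero hs ih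

lemma esymmMean_replicate (n : ℕ) (a : ℝ) {j : ℕ} (hj : j ≤ n) :
    (replicate n a).esymmMean j = a ^ j := by
  induction n generalizing j with
  | zero => simp [Nat.le_zero.1 hj, esymmMean_zero]
  | succ n ih =>
    rcases j with _ | j
    · simp [esymmMean_zero]
    have e := esymmMean_cons_succ a (replicate n a) j
    rw [← replicate_succ, card_replicate, ih (by omega : j ≤ n)] at e
    have h : ((n : ℝ) - j) * (replicate n a).esymmMean (j + 1) = (n - j) * a ^ (j + 1) := by
      rcases (Nat.le_of_succ_le_succ hj).lt_or_eq with h | h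
      · rw [ih (by omega)]
      · simp [h]
    rw [h] at e
    have hn : (n : ℝ) + 1 ≠ 0 := by positivity
    apply mul_left_cancel₀ hn
    rw [e]; ring

/-- The inductive step for Newton's inequality. With `p` the means of `x ::ₘ s` and `q` those of
`s`, the defect `p (j + 1) ^ 2 - p j * p (j + 2)` dominates a combination, with nonnegative
coefficients, of a square and of two defects of `q`. The role of `q (j - 1)` is played by `a`, which
may be taken to be `0` when `j = 0`. -/
lemma newton_defect_cons {s : Multiset ℝ} {x : ℝ} (hx : 0 ≤ x) {j : ℕ} (hj : j < s.card) {a : ℝ}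
    (hp : ((s.card : ℝ) + 1) * (x ::ₘ s).esymmMean j
      = ((s.card : ℝ) - j + 1) * s.esymmMean j + j * x * a)
    (had : a * s.esymmMean (j + 2) ≤ s.esymmMean j * s.esymmMean (j + 1)) :
    (s.esymmMean (j + 1) - x * s.esymmMean j) ^ 2
      + (((s.card : ℝ) - j) ^ 2 - 1)
        * (s.esymmMean (j + 1) ^ 2 - s.esymmMean j * s.esymmMean (j + 2))
      + x ^ 2 * (((j : ℝ) + 1) ^ 2 - 1) * (s.esymmMean j ^ 2 - a * s.esymmMean (j + 1))
      ≤ ((s.card : ℝ) + 1) ^ 2 * ((x ::ₘ s).esymmMean (j + 1) ^ 2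
          - (x ::ₘ s).esymmMean j * (x ::ₘ s).esymmMean (j + 2)) := by
  have e1 := esymmMean_cons_succ x s j
  have e2 := esymmMean_cons_succ x s (j + 1)
  push_cast at e2
  have hl : (1 : ℝ) ≤ (s.card : ℝ) - j := by
    have : (j : ℝ) + 1 ≤ s.card := by exact_mod_cast hj
    linarith
  have hrw : ((s.card : ℝ) + 1) ^ 2 * ((x ::ₘ s).esymmMean (j + 1) ^ 2
      - (x ::ₘ s).esymmMean j * (x ::ₘ s).esymmMean (j + 2))
      = (((s.card : ℝ) + 1) * (x ::ₘ s).esymmMean (j + 1)) ^ 2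
        - (((s.card : ℝ) + 1) * (x ::ₘ s).esymmMean j)
          * (((s.card : ℝ) + 1) * (x ::ₘ s).esymmMean (j + 2)) := by ring
  rw [hrw, e1, e2, hp]
  have key : 0 ≤ x * ((s.card : ℝ) - j - 1) * j
      * (s.esymmMean j * s.esymmMean (j + 1) - a * s.esymmMean (j + 2)) :=
    mul_nonneg (mul_nonneg (mul_nonneg hx (by linarith)) (Nat.cast_nonneg j)) (by linarith)
  refine le_of_sub_nonneg (key.trans_eq ?_)
  ring

/-- Log-concavity at two consecutive places spreads to a gap of three. -/
lemma esymmMean_mul_le_mul_of_log_concave {s : Multiset ℝ} (hs : ∀ a ∈ s, 0 ≤ a)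
    (h : ∀ j, s.esymmMean j * s.esymmMean (j + 2) ≤ s.esymmMean (j + 1) ^ 2) (j : ℕ) :
    s.esymmMean j * s.esymmMean (j + 3) ≤ s.esymmMean (j + 1) * s.esymmMean (j + 2) := by
  have hq := esymmMean_nonneg hs
  rcases (hq (j + 2)).eq_or_lt with h0 | h2
  · simp [esymmMean_eq_zero_of_le hs (Nat.le_succ (j + 2)) h0.symm, ← h0]
  have h1 : 0 < s.esymmMean (j + 1) :=
    (hq _).lt_of_ne fun h0 => h2.ne' (esymmMean_succ_eq_zero hs h0.symm)
  refine le_of_mul_le_mul_right ?_ (mul_pos h1 h2)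
  calc s.esymmMean j * s.esymmMean (j + 3) * (s.esymmMean (j + 1) * s.esymmMean (j + 2))
      = (s.esymmMean j * s.esymmMean (j + 2)) * (s.esymmMean (j + 1) * s.esymmMean (j + 3)) := by
        ring
    _ ≤ s.esymmMean (j + 1) ^ 2 * s.esymmMean (j + 2) ^ 2 :=
        mul_le_mul (h j) (h (j + 1)) (mul_nonneg (hq _) (hq _)) (sq_nonneg _)
    _ = _ := by ring

/-- The second defect in `newton_defect_cons` is nonnegative, so the first two terms bound the
defect of `x ::ₘ s` from below. -/
lemma newton_defect_cons_le {s : Multiset ℝ} {x : ℝ} (hx : 0 ≤ x) (hs : ∀ a ∈ s, 0 ≤ a)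
    (hs2 : ∀ j, s.esymmMean j * s.esymmMean (j + 2) ≤ s.esymmMean (j + 1) ^ 2)
    {j : ℕ} (hj : j < s.card) :
    (s.esymmMean (j + 1) - x * s.esymmMean j) ^ 2
      + (((s.card : ℝ) - j) ^ 2 - 1)
        * (s.esymmMean (j + 1) ^ 2 - s.esymmMean j * s.esymmMean (j + 2))
      ≤ ((s.card : ℝ) + 1) ^ 2 * ((x ::ₘ s).esymmMean (j + 1) ^ 2
          - (x ::ₘ s).esymmMean j * (x ::ₘ s).esymmMean (j + 2)) := by
  rcases j with _ | j
  · have h := newton_defect_cons (s := s) (a := 0) hx hj (by simp [esymmMean_zero])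
      (by simpa using mul_nonneg (esymmMean_nonneg hs 0) (esymmMean_nonneg hs 1))
    simpa using h
  · refine le_trans (le_add_of_nonneg_right ?_) (newton_defect_cons (s := s)
      (a := s.esymmMean j) hx hj (by rw [esymmMean_cons_succ]; push_cast; ring)
      (esymmMean_mul_le_mul_of_log_concave hs hs2 j))
    refine mul_nonneg (mul_nonneg (sq_nonneg _) ?_) (by linarith [hs2 j])
    push_cast; nlinarith [Nat.cast_nonneg (α := ℝ) j]

/-- **Newton's inequality**: the means of a multiset of nonnegative numbers are log-concave. -/
theorem esymmMean_mul_le_sq {s : Multiset ℝ} (hs : ∀ a ∈ s, 0 ≤ a) (j : ℕ) :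
    s.esymmMean j * s.esymmMean (j + 2) ≤ s.esymmMean (j + 1) ^ 2 := by
  induction s using Multiset.induction generalizing j with
  | empty => rw [esymmMean_of_card_lt (j := j + 2) (by simp), mul_zero]; positivity
  | cons x s ih =>
    have hx : 0 ≤ x := hs x (mem_cons_self x s)
    have hs' : ∀ a ∈ s, 0 ≤ a := fun a ha => hs a (mem_cons_of_mem ha)
    have hq := esymmMean_nonneg hs'
    rcases lt_or_ge j s.card with hj | hj
    swap
    · rw [esymmMean_of_card_lt (j := j + 2) (by rw [card_cons]; omega), mul_zero]; positivity
    have hl : (1 : ℝ) ≤ (s.card : ℝ) - j := by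
      have : (j : ℝ) + 1 ≤ s.card := by exact_mod_cast hj
      linarith
    have hN : (0 : ℝ) < ((s.card : ℝ) + 1) ^ 2 := by positivity
    have hb : 0 ≤ (((s.card : ℝ) - j) ^ 2 - 1)
        * (s.esymmMean (j + 1) ^ 2 - s.esymmMean j * s.esymmMean (j + 2)) :=
      mul_nonneg (by nlinarith) (by linarith [ih hs' j])
    rw [← sub_nonneg]
    refine nonneg_of_mul_nonneg_right ?_ hN
    exact (add_nonneg (sq_nonneg _) hb).trans (newton_defect_cons_le hx hs' (ih hs') hj)

/-- **Newton's inequality** is strict at a nonzero place unless all the numbers are equal. -/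
theorem esymmMean_mul_lt_sq {s : Multiset ℝ} (hs : ∀ a ∈ s, 0 ≤ a)
    (hne : ∃ a ∈ s, ∃ b ∈ s, a ≠ b) {j : ℕ} (hj0 : s.esymmMean (j + 1) ≠ 0) :
    s.esymmMean j * s.esymmMean (j + 2) < s.esymmMean (j + 1) ^ 2 := by
  induction s using Multiset.induction generalizing j with
  | empty => simp at hne
  | cons x s ih =>
    have hx : 0 ≤ x := hs x (mem_cons_self x s)
    have hs' : ∀ a ∈ s, 0 ≤ a := fun a ha => hs a (mem_cons_of_mem ha)
    have hq := esymmMean_nonneg hs'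
    by_cases hj2 : (x ::ₘ s).esymmMean (j + 2) = 0
    · rw [hj2, mul_zero]; positivity
    have hj : j < s.card := by
      by_contra h
      exact hj2 (esymmMean_of_card_lt (by rw [card_cons]; omega))
    have hl : (1 : ℝ) ≤ (s.card : ℝ) - j := by
      have : (j : ℝ) + 1 ≤ s.card := by exact_mod_cast hj
      linarith
    -- The means of `s` at `j` and `j + 1` are nonzero, as that of `x ::ₘ s` at `j + 2` is.
    have hc : s.esymmMean (j + 1) ≠ 0 := by
      intro h
      have e := esymmMean_cons_succ x s (j + 1)
      rw [h, esymmMean_succ_eq_zero hs' h, mul_zero, mul_zero, add_zero] at e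
      exact hj2 ((mul_eq_zero.1 e).resolve_left (by positivity))
    have hb : s.esymmMean j ≠ 0 := fun h => hc (esymmMean_succ_eq_zero hs' h)
    have hN : (0 : ℝ) < ((s.card : ℝ) + 1) ^ 2 := by positivity
    rw [← sub_pos]
    refine (mul_pos_iff_of_pos_left hN).1 ?_
    have hA : 0 ≤ ((s.card : ℝ) - j) ^ 2 - 1 := by nlinarith
    have hb0 : 0 ≤ (((s.card : ℝ) - j) ^ 2 - 1)
        * (s.esymmMean (j + 1) ^ 2 - s.esymmMean j * s.esymmMean (j + 2)) :=
      mul_nonneg hA (by linarith [esymmMean_mul_le_sq hs' j])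
    by_cases hall : ∃ a ∈ s, ∃ b ∈ s, a ≠ b
    · rcases hl.eq_or_lt with h1 | h1
      · -- Here `j + 1 = card s`, the coefficient of the first defect of `s` vanishes, and the
        -- second defect is the positive one.
        have hjs : j + 1 = s.card := by
          have : (j : ℝ) + 1 = s.card := by linarith
          exact_mod_cast this
        have hx0 : x ≠ 0 := by
          rintro rfl
          have e := esymmMean_cons_succ 0 s (j + 1)
          rw [esymmMean_of_card_lt (s := s) (j := j + 1 + 1) (by omega), mul_zero, mul_zero,
            zero_mul, add_zero] at e
          exact hj2 ((mul_eq_zero.1 e).resolve_left (by positivity))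
        rcases j with _ | j
        · obtain ⟨c, rfl⟩ := card_eq_one.1 hjs.symm
          obtain ⟨a, ha, b, hb, hab⟩ := hall
          exact absurd ((mem_singleton.1 ha).trans (mem_singleton.1 hb).symm) hab
        · refine lt_of_lt_of_le ?_ (newton_defect_cons (s := s) (a := s.esymmMean j) hx hj
            (by rw [esymmMean_cons_succ]; push_cast; ring)
            (esymmMean_mul_le_mul_of_log_concave hs' (esymmMean_mul_le_sq hs') j))
          refine add_pos_of_nonneg_of_pos (add_nonneg (sq_nonneg _) hb0)
            (mul_pos (mul_pos (by positivity) ?_) (by linarith [ih hs' hall hb]))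
          push_cast; nlinarith [Nat.cast_nonneg (α := ℝ) j]
      · have hpos : 0 < (((s.card : ℝ) - j) ^ 2 - 1)
            * (s.esymmMean (j + 1) ^ 2 - s.esymmMean j * s.esymmMean (j + 2)) :=
          mul_pos (by nlinarith) (by linarith [ih hs' hall hc])
        exact (add_pos_of_nonneg_of_pos (sq_nonneg _) hpos).trans_le
          (newton_defect_cons_le hx hs' (esymmMean_mul_le_sq hs') hj)
    · -- All entries of `s` are equal to some `a ≠ x`, and the square is positive.
      push Not at hall
      obtain ⟨a, ha⟩ := card_pos_iff_exists_mem.1 (by omega : 0 < s.card)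
      have hsa : s = replicate s.card a := eq_replicate_card.2 fun b hb => hall b hb a ha
      have hxa : x ≠ a := by
        rintro rfl
        obtain ⟨c, hc, d, hd, hcd⟩ := hne
        have : ∀ c ∈ x ::ₘ s, c = x := fun c hc =>
          (mem_cons.1 hc).elim id fun h => hall c h x ha
        exact hcd ((this c hc).trans (this d hd).symm)
      have e0 : s.esymmMean j = a ^ j := by rw [hsa]; exact esymmMean_replicate _ _ hj.le
      have e1 : s.esymmMean (j + 1) = a ^ (j + 1) := by
        rw [hsa]; exact esymmMean_replicate _ _ hj
      have hsq : 0 < (s.esymmMean (j + 1) - x * s.esymmMean j) ^ 2 := by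
        refine sq_pos_of_ne_zero ?_
        rw [e1, e0, pow_succ, mul_comm, ← sub_mul]
        exact mul_ne_zero (sub_ne_zero.2 hxa.symm) (e0 ▸ hb)
      exact (add_pos_of_pos_of_nonneg hsq hb0).trans_le
        (newton_defect_cons_le hx hs' (esymmMean_mul_le_sq hs') hj)

/-- A log-concave sequence lies below the geometric sequence through two consecutive terms. -/
lemma esymmMean_div_pow_le {s : Multiset ℝ} (hs : ∀ a ∈ s, 0 ≤ a) {k : ℕ}
    (hk : 0 < s.esymmMean (k + 1)) (j : ℕ) :
    s.esymmMean j * ((s.esymmMean (k + 1) / s.esymmMean k) ^ (k + 1)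
      / (s.esymmMean (k + 1) / s.esymmMean k) ^ j) ≤ s.esymmMean (k + 1) := by
  have hq := esymmMean_nonneg hs
  have hpos : ∀ i ≤ k + 1, 0 < s.esymmMean i := fun i hi =>
    (hq i).lt_of_ne fun h => hk.ne' (esymmMean_eq_zero_of_le hs hi h.symm)
  have hk0 := hpos k k.le_succ
  set r := s.esymmMean (k + 1) / s.esymmMean k with hr
  have hr0 : 0 < r := div_pos hk hk0
  have hrk : r * s.esymmMean k = s.esymmMean (k + 1) := div_mul_cancel₀ _ hk0.ne'
  have up : ∀ i, k ≤ i → s.esymmMean (i + 1) ≤ r * s.esymmMean i := by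
    intro i hi
    induction i, hi using Nat.le_induction with
    | base => exact hrk.ge
    | succ i _ ih =>
      rcases (hq i).eq_or_lt with h0 | h0
      · have h1 := esymmMean_succ_eq_zero hs h0.symm
        rw [h1, esymmMean_succ_eq_zero hs h1, mul_zero]
      · refine le_of_mul_le_mul_left ?_ h0
        calc _ ≤ s.esymmMean (i + 1) ^ 2 := esymmMean_mul_le_sq hs i
          _ ≤ s.esymmMean (i + 1) * (r * s.esymmMean i) := by
            rw [sq]; exact mul_le_mul_of_nonneg_left ih (hq _)
          _ = _ := by ring
  have down : ∀ i, i ≤ k → r * s.esymmMean i ≤ s.esymmMean (i + 1) := by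
    intro i hi
    induction hi using Nat.decreasingInduction with
    | self => exact hrk.le
    | of_succ i hi ih =>
      refine le_of_mul_le_mul_right ?_ (hpos (i + 1) (by omega))
      calc r * s.esymmMean i * s.esymmMean (i + 1) = s.esymmMean i * (r * s.esymmMean (i + 1)) := by
            ring
        _ ≤ s.esymmMean i * s.esymmMean (i + 2) := mul_le_mul_of_nonneg_left ih (hq i)
        _ ≤ s.esymmMean (i + 1) ^ 2 := esymmMean_mul_le_sq hs i
        _ = _ := sq _
  rcases le_total j (k + 1) with hj | hj
  · obtain ⟨d, hd⟩ := Nat.exists_eq_add_of_le hj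
    have hdiv : r ^ (k + 1) / r ^ j = r ^ d := by
      rw [hd, pow_add, mul_div_cancel_left₀ _ (pow_pos hr0 j).ne']
    rw [hdiv]
    have : ∀ d, j + d ≤ k + 1 → s.esymmMean j * r ^ d ≤ s.esymmMean (j + d) := by
      intro d
      induction d with
      | zero => simp
      | succ d ih =>
        intro hd
        calc s.esymmMean j * r ^ (d + 1) = r * (s.esymmMean j * r ^ d) := by ring
          _ ≤ r * s.esymmMean (j + d) := mul_le_mul_of_nonneg_left (ih (by omega)) hr0.le
          _ ≤ _ := down (j + d) (by omega)
    exact (this d hd.ge).trans_eq (by rw [hd])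
  · obtain ⟨d, rfl⟩ := Nat.exists_eq_add_of_le hj
    rw [pow_add r (k + 1) d, div_mul_cancel_left₀ (pow_pos hr0 _).ne', ← div_eq_mul_inv,
      div_le_iff₀ (pow_pos hr0 d)]
    induction d with
    | zero => simp
    | succ d ih =>
      calc s.esymmMean (k + 1 + d + 1) ≤ r * s.esymmMean (k + 1 + d) := up _ (by omega)
        _ ≤ r * (s.esymmMean (k + 1) * r ^ d) :=
          mul_le_mul_of_nonneg_left (ih (by omega)) hr0.le
        _ = _ := by ring

end Multiset

/-! ### The Halász–Székely mean as an infimum over `y` -/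

namespace HalaszSzekely

lemma lintegral_empirical {n : ℕ} (x : Fin n → ℝ≥0) (f : ℝ≥0 → ℝ≥0∞) :
    ∫⁻ t, f t ∂(empirical x) = (n : ℝ≥0∞)⁻¹ * ∑ i, f (x i) := by
  simp [empirical, lintegral_smul_measure, lintegral_finsetSum_measure]

lemma lintegral_empirical_ofReal {n : ℕ} (x : Fin n → ℝ≥0) (f : ℝ≥0 → ℝ≥0∞) {g : Fin n → ℝ}
    (hf : ∀ i, f (x i) = ENNReal.ofReal (g i)) :
    ((∫⁻ t, f t ∂(empirical x) : ℝ≥0∞) : EReal) = (((n : ℝ)⁻¹ * ∑ i, max (g i) 0 : ℝ) : EReal) := by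
  rcases Nat.eq_zero_or_pos n with rfl | hn
  · simp [lintegral_empirical]
  have h : ∫⁻ t, f t ∂(empirical x) = ENNReal.ofReal ((n : ℝ)⁻¹ * ∑ i, max (g i) 0) := by
    rw [lintegral_empirical, ENNReal.ofReal_mul (by positivity),
      ENNReal.ofReal_inv_of_pos (by exact_mod_cast hn), ENNReal.ofReal_natCast,
      ENNReal.ofReal_sum_of_nonneg fun i _ => le_max_right _ _]
    simp [hf, ENNReal.ofReal_max]
  rw [h, EReal.coe_ennreal_ofReal, max_eq_left]
  exact mul_nonneg (by positivity) (Finset.sum_nonneg fun i _ => le_max_right _ _)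

lemma extIntegral_empirical_of_real {n : ℕ} (x : Fin n → ℝ≥0) (f : ℝ≥0 → EReal) {g : Fin n → ℝ}
    (hf : ∀ i, f (x i) = g i) :
    extIntegral (empirical x) f = (((n : ℝ)⁻¹ * ∑ i, g i : ℝ) : EReal) := by
  rw [extIntegral, lintegral_empirical_ofReal x _ (g := g) fun i => by
      rw [hf, EReal.real_coe_toENNReal],
    lintegral_empirical_ofReal x _ (g := fun i => -g i) fun i => by
      rw [hf, ← EReal.coe_neg, EReal.real_coe_toENNReal],
    ← EReal.coe_sub, ← mul_sub, ← Finset.sum_sub_distrib]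
  refine congrArg (fun a : ℝ => (((n : ℝ)⁻¹ * a : ℝ) : EReal))
    (Finset.sum_congr rfl fun i _ => ?_)
  rcases le_total 0 (g i) with h | h
  · rw [max_eq_left h, max_eq_right (by linarith), sub_zero]
  · rw [max_eq_right h, max_eq_left (by linarith)]; ring

lemma extIntegral_empirical_of_bot {n : ℕ} (x : Fin n → ℝ≥0) (f : ℝ≥0 → EReal)
    (hf : ∀ i, f (x i) ≠ ⊤) {i : Fin n} (hi : f (x i) = ⊥) :
    extIntegral (empirical x) f = ⊥ := by
  have hn : (n : ℝ≥0∞) ≠ ⊤ := ENNReal.natCast_ne_top n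
  have h1 : ∫⁻ t, (f t).toENNReal ∂(empirical x) ≠ ⊤ := by
    have hn0 : (n : ℝ≥0∞) ≠ 0 := by exact_mod_cast (Fin.pos i).ne'
    rw [lintegral_empirical]
    refine ENNReal.mul_ne_top (ENNReal.inv_ne_top.2 hn0) (ENNReal.sum_ne_top.2 fun j _ => ?_)
    exact EReal.toENNReal_ne_top_iff.2 (hf j)
  have h2 : ∫⁻ t, (-f t).toENNReal ∂(empirical x) = ⊤ := by
    rw [lintegral_empirical, ENNReal.sum_eq_top.2 ⟨i, Finset.mem_univ i, by simp [hi]⟩]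
    exact ENNReal.mul_top (ENNReal.inv_ne_zero.2 hn)
  rw [extIntegral, h2]
  rw [← ENNReal.coe_toNNReal h1]
  rfl

/-- The function of `y` whose infimum over `y > 0` is the `k`-th power of the Halász–Székely mean
with parameter `k / n`. -/
noncomputable def profile {n : ℕ} (k : ℕ) (x : Fin n → ℝ≥0) (y : ℝ) : ℝ :=
  y ^ k * ∏ i, ((k : ℝ) / n * y⁻¹ * (x i : ℝ) + 1 - (k : ℝ) / n)

lemma profile_factor_nonneg {n k : ℕ} (hkn : k ≤ n) (x : ℝ≥0) {y : ℝ} (hy : 0 < y) :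
    0 ≤ (k : ℝ) / n * y⁻¹ * (x : ℝ) + 1 - (k : ℝ) / n := by
  have : (k : ℝ) / n ≤ 1 := div_le_one_of_le₀ (by exact_mod_cast hkn) (Nat.cast_nonneg n)
  have : 0 ≤ (k : ℝ) / n * y⁻¹ * (x : ℝ) := by positivity
  linarith

lemma profile_nonneg {n k : ℕ} (hkn : k ≤ n) (x : Fin n → ℝ≥0) {y : ℝ} (hy : 0 < y) :
    0 ≤ profile k x y :=
  mul_nonneg (pow_nonneg hy.le k) (Finset.prod_nonneg fun i _ => profile_factor_nonneg hkn (x i) hy)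

lemma exp_extIntegral_kernel {n k : ℕ} (hk : 1 ≤ k) (hkn : k ≤ n) (x : Fin n → ℝ≥0) {y : ℝ}
    (hy : 0 < y) :
    EReal.exp (extIntegral (empirical x) fun t => kernel t y ((k : ℝ) / n))
      = ENNReal.ofReal (profile k x y ^ (1 / (k : ℝ))) := by
  have hk0 : (0 : ℝ) < k := by exact_mod_cast hk
  have hn0 : (0 : ℝ) < n := by exact_mod_cast hk.trans hkn
  have hc : 0 < (k : ℝ) / n := by positivity
  have hc' : (0 : ℝ) < ((k : ℝ) / n)⁻¹ := inv_pos.2 hc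
  simp only [kernel, if_pos hc]
  by_cases h : ∀ i, 0 < (k : ℝ) / n * y⁻¹ * (x i : ℝ) + 1 - (k : ℝ) / n
  · rw [extIntegral_empirical_of_real x _ (g := fun i =>
      Real.log y + ((k : ℝ) / n)⁻¹ * Real.log ((k : ℝ) / n * y⁻¹ * (x i : ℝ) + 1 - (k : ℝ) / n))
      fun i => by rw [ENNReal.log_ofReal_of_pos (h i)]; norm_cast]
    have hP : 0 < ∏ i, ((k : ℝ) / n * y⁻¹ * (x i : ℝ) + 1 - (k : ℝ) / n) :=
      Finset.prod_pos fun i _ => h i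
    rw [EReal.exp_coe, profile, Real.rpow_def_of_pos (mul_pos (pow_pos hy k) hP),
      Real.log_mul (pow_pos hy k).ne' hP.ne', Real.log_pow, Real.log_prod fun i _ => (h i).ne']
    congr 2
    rw [Finset.sum_add_distrib, ← Finset.mul_sum]
    simp only [Finset.sum_const, Finset.card_univ, Fintype.card_fin, nsmul_eq_mul]
    field_simp
  · -- A factor vanishes: the integral is `-∞` and both sides are zero.
    push Not at h
    obtain ⟨i, hi⟩ := h
    have hv := le_antisymm hi (profile_factor_nonneg hkn (x i) hy)
    rw [extIntegral_empirical_of_bot x _ (i := i), EReal.exp_bot, profile,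
      Finset.prod_eq_zero (Finset.mem_univ i) hv, mul_zero,
      Real.zero_rpow (by positivity), ENNReal.ofReal_zero]
    · intro j
      rw [ENNReal.log_ofReal]
      split_ifs
      · rw [EReal.coe_mul_bot_of_pos hc', EReal.add_bot]; exact bot_ne_top
      · rw [← EReal.coe_mul, ← EReal.coe_add]; exact EReal.coe_ne_top _
    · rw [hv, ENNReal.ofReal_zero, ENNReal.log_zero, EReal.coe_mul_bot_of_pos hc', EReal.add_bot]

lemma hsm_eq_iInf_profile {n k : ℕ} (hk : 1 ≤ k) (hkn : k ≤ n) (x : Fin n → ℝ≥0) :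
    hsm ((k : ℝ) / n) x
      = ⨅ (y : ℝ) (_ : 0 < y), ENNReal.ofReal (profile k x y ^ (1 / (k : ℝ))) := by
  rw [hsm, barycenter, ← EReal.expOrderIso_apply, OrderIso.map_iInf]
  refine iInf_congr fun y => ?_
  rw [OrderIso.map_iInf]
  exact iInf_congr fun hy => exp_extIntegral_kernel hk hkn x hy

end HalaszSzekely

/-! ### The entries and the binomial weights -/

namespace HalaszSzekely

/-- The entries of a tuple of nonnegative numbers, as a multiset of reals. -/
def entries {n : ℕ} (x : Fin n → ℝ≥0) : Multiset ℝ :=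
  Finset.univ.val.map fun i => (x i : ℝ)

lemma card_entries {n : ℕ} (x : Fin n → ℝ≥0) : (entries x).card = n := by simp [entries]

lemma entries_nonneg {n : ℕ} (x : Fin n → ℝ≥0) : ∀ a ∈ entries x, 0 ≤ a := by
  simp [entries]

lemma esymmMean_entries_nonneg {n : ℕ} (x : Fin n → ℝ≥0) (j : ℕ) :
    0 ≤ (entries x).esymmMean j :=
  Multiset.esymmMean_nonneg (entries_nonneg x) j

lemma esymm_entries {n : ℕ} (x : Fin n → ℝ≥0) (j : ℕ) :
    (entries x).esymm j
      = ((∑ t ∈ Finset.univ.powersetCard j, ∏ i ∈ t, x i : ℝ≥0) : ℝ) := by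
  rw [entries, Finset.esymm_map_val]
  push_cast
  rfl

lemma coe_sym {n : ℕ} (k : ℕ) (x : Fin n → ℝ≥0) :
    (sym k x : ℝ≥0∞) = ENNReal.ofReal ((entries x).esymmMean k ^ (1 / (k : ℝ))) := by
  have h : (entries x).esymmMean k ^ (1 / (k : ℝ)) = (sym k x : ℝ) := by
    rw [sym, NNReal.coe_rpow, Multiset.esymmMean, esymm_entries, card_entries]
    simp [MvPolynomial.esymm]
  rw [h, ENNReal.ofReal_coe_nnreal]

/-- The probability of the value `j` under the binomial distribution with parameters `n` and
`k / n`. -/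
noncomputable def weight (n k j : ℕ) : ℝ :=
  n.choose j * ((k : ℝ) / n) ^ j * (1 - (k : ℝ) / n) ^ (n - j)

lemma natCast_div_le_one {n k : ℕ} (hkn : k ≤ n) : (k : ℝ) / n ≤ 1 :=
  div_le_one_of_le₀ (by exact_mod_cast hkn) (Nat.cast_nonneg n)

lemma weight_nonneg {n k : ℕ} (hkn : k ≤ n) (j : ℕ) : 0 ≤ weight n k j := by
  have := sub_nonneg.2 (natCast_div_le_one hkn)
  unfold weight; positivity

lemma weight_pos {n k : ℕ} (hk : 1 ≤ k) (hkn : k < n) {j : ℕ} (hj : j ≤ n) :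
    0 < weight n k j := by
  have h0 : (0 : ℝ) < k := by exact_mod_cast hk
  have hn : (0 : ℝ) < n := h0.trans (by exact_mod_cast hkn)
  have h1 : 0 < 1 - (k : ℝ) / n := by
    rw [sub_pos, div_lt_one hn]; exact_mod_cast hkn
  have h2 : (0 : ℝ) < n.choose j := by exact_mod_cast Nat.choose_pos hj
  unfold weight; positivity

lemma weight_self {n : ℕ} (hn : 1 ≤ n) : weight n n n = 1 := by
  have : (n : ℝ) ≠ 0 := by exact_mod_cast (by omega : n ≠ 0)
  simp [weight, this]

lemma weight_self_pos {n k : ℕ} (hk : 1 ≤ k) (hkn : k ≤ n) : 0 < weight n k k := by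
  rcases hkn.lt_or_eq with h | rfl
  · exact weight_pos hk h hkn
  · rw [weight_self hk]; exact one_pos

lemma sum_weight (n k : ℕ) : ∑ j ∈ Finset.range (n + 1), weight n k j = 1 := by
  have h := add_pow ((k : ℝ) / n) (1 - (k : ℝ) / n) n
  rw [add_sub_cancel, one_pow] at h
  rw [h]
  exact Finset.sum_congr rfl fun j _ => by rw [weight]; ring

/-- The constant of the upper bound is the `-1 / k`-th power of the binomial weight at `k`. -/
lemma choose_rpow_div_B {n k : ℕ} (hk : 1 ≤ k) (hkn : k ≤ n) :
    (n.choose k : ℝ) ^ (-(1 / (k : ℝ))) / B ((k : ℝ) / n) = weight n k k ^ (-(1 / (k : ℝ))) := by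
  have hk0 : (0 : ℝ) < k := by exact_mod_cast hk
  have hn0 : (0 : ℝ) < n := by exact_mod_cast hk.trans hkn
  have hc : 0 < (k : ℝ) / n := by positivity
  rcases hkn.lt_or_eq with h | rfl
  · have h1 : 0 < 1 - (k : ℝ) / n := by
      rw [sub_pos, div_lt_one hn0]; exact_mod_cast h
    have hch : (0 : ℝ) < n.choose k := by exact_mod_cast Nat.choose_pos hkn
    have hB : B ((k : ℝ) / n)
        = (((k : ℝ) / n) ^ k * (1 - (k : ℝ) / n) ^ (n - k)) ^ (1 / (k : ℝ)) := by
      rw [B, if_neg hc.ne', if_neg (by linarith), Real.mul_rpow (by positivity) (by positivity),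
        ← Real.rpow_natCast, ← Real.rpow_natCast, ← Real.rpow_mul hc.le, ← Real.rpow_mul h1.le,
        Nat.cast_sub hkn, mul_one_div_cancel hk0.ne', Real.rpow_one]
      congr 2
      field_simp
    have hpq : 0 < ((k : ℝ) / n) ^ k * (1 - (k : ℝ) / n) ^ (n - k) := by positivity
    rw [hB, weight, mul_assoc, Real.mul_rpow hch.le hpq.le, Real.rpow_neg hpq.le, div_eq_mul_inv]
  · rw [weight_self hk, div_self hn0.ne']
    simp [B]

/-! ### Bounds for the profile -/

lemma profile_eq_sum {n k : ℕ} (x : Fin n → ℝ≥0) (y : ℝ) :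
    profile k x y = ∑ j ∈ Finset.range (n + 1),
      weight n k j * ((entries x).esymmMean j * (y ^ k / y ^ j)) := by
  have h : ∏ i, ((k : ℝ) / n * y⁻¹ * (x i : ℝ) + 1 - (k : ℝ) / n)
      = ((entries x).map fun a => (k : ℝ) / n * y⁻¹ * a + (1 - (k : ℝ) / n)).prod := by
    simp only [entries, Multiset.map_map, Function.comp_def, Finset.prod_map_val, add_sub_assoc]
  rw [profile, h, Multiset.prod_map_mul_add_eq_sum_esymm, Finset.mul_sum, card_entries]
  refine Finset.sum_congr rfl fun j _ => ?_
  rw [weight, ← Multiset.choose_mul_esymmMean, card_entries, mul_pow, inv_pow]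
  ring

lemma profile_term_nonneg {n k : ℕ} (hkn : k ≤ n) (x : Fin n → ℝ≥0) {y : ℝ} (hy : 0 < y) (j : ℕ) :
    0 ≤ weight n k j * ((entries x).esymmMean j * (y ^ k / y ^ j)) :=
  mul_nonneg (weight_nonneg hkn j) (mul_nonneg (esymmMean_entries_nonneg x j) (by positivity))

lemma weight_mul_le_profile {n k : ℕ} (hkn : k ≤ n) (x : Fin n → ℝ≥0) {y : ℝ} (hy : 0 < y) :
    weight n k k * (entries x).esymmMean k ≤ profile k x y := by
  rw [profile_eq_sum x y]
  refine le_trans (le_of_eq ?_) (Finset.single_le_sum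
    (fun j _ => profile_term_nonneg hkn x hy j) (Finset.mem_range.2 (Nat.lt_succ_of_le hkn)))
  rw [div_self (pow_pos hy k).ne', mul_one]

/-- The terms next to the main one keep the profile away from its main term, uniformly in `y`. -/
lemma exists_lt_le_profile {n k : ℕ} (hk : 1 ≤ k) (hkn : k < n) (x : Fin n → ℝ≥0)
    (hp : (entries x).esymmMean (k + 1) ≠ 0) :
    ∃ L, weight n k k * (entries x).esymmMean k < L ∧ ∀ y, 0 < y → L ≤ profile k x y := by
  obtain ⟨m, rfl⟩ := Nat.exists_eq_add_of_le' hk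
  have hpm : (entries x).esymmMean m ≠ 0 := fun h =>
    hp (Multiset.esymmMean_eq_zero_of_le (entries_nonneg x) (by omega) h)
  set a := weight n (m + 1) m * (entries x).esymmMean m with ha
  set b := weight n (m + 1) (m + 2) * (entries x).esymmMean (m + 2) with hb
  have ha0 : 0 < a :=
    mul_pos (weight_pos hk hkn (by omega)) ((esymmMean_entries_nonneg x m).lt_of_ne' hpm)
  have hb0 : 0 < b :=
    mul_pos (weight_pos hk hkn (by omega)) ((esymmMean_entries_nonneg x _).lt_of_ne' hp)
  -- The terms on both sides of the main one add up to `a * y + b / y`, which is at least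
  -- `min a b`: consider `y ≥ 1` and `y ≤ 1`.
  refine ⟨_, lt_add_of_pos_right _ (lt_min ha0 hb0), fun y hy => ?_⟩
  rw [profile_eq_sum x y]
  have hsub : ({m, m + 1, m + 2} : Finset ℕ) ⊆ Finset.range (n + 1) := by
    intro j hj
    simp only [Finset.mem_insert, Finset.mem_singleton] at hj
    rw [Finset.mem_range]; omega
  refine le_trans ?_ (Finset.sum_le_sum_of_subset_of_nonneg hsub
    fun j _ _ => profile_term_nonneg hkn.le x hy j)
  rw [Finset.sum_insert (by simp), Finset.sum_insert (by simp), Finset.sum_singleton]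
  have e1 : weight n (m + 1) m * ((entries x).esymmMean m * (y ^ (m + 1) / y ^ m)) = a * y := by
    rw [pow_succ, mul_div_cancel_left₀ _ (pow_pos hy m).ne', ha]; ring
  have e2 : weight n (m + 1) (m + 2) * ((entries x).esymmMean (m + 2) * (y ^ (m + 1) / y ^ (m + 2)))
      = b / y := by
    rw [pow_succ y (m + 1), div_mul_cancel_left₀ (pow_pos hy _).ne', hb]; ring
  rw [e1, e2, div_self (pow_pos hy _).ne', mul_one]
  have : min a b ≤ a * y + b / y := by
    rcases le_total 1 y with h | h
    · have : 0 < b / y := by positivity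
      nlinarith [min_le_left a b]
    · have : b ≤ b / y := (le_div_iff₀ hy).2 (by nlinarith)
      nlinarith [min_le_right a b, mul_pos ha0 hy]
  linarith

/-- The comparison point is `y = p k / p (k - 1)`, where `p` denotes the means of the entries. -/
lemma exists_profile_le {n k : ℕ} (hk : 1 ≤ k) (hkn : k ≤ n) (x : Fin n → ℝ≥0)
    (hp : (entries x).esymmMean k ≠ 0) :
    ∃ y, 0 < y ∧ profile k x y ≤ (entries x).esymmMean k ∧
      (k < n → (∃ i j, x i ≠ x j) → profile k x y < (entries x).esymmMean k) := by
  obtain ⟨m, rfl⟩ := Nat.exists_eq_add_of_le' hk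
  have hpm : (entries x).esymmMean m ≠ 0 := fun h =>
    hp (Multiset.esymmMean_eq_zero_of_le (entries_nonneg x) m.le_succ h)
  have hk0 := (esymmMean_entries_nonneg x (m + 1)).lt_of_ne' hp
  have hm0 := (esymmMean_entries_nonneg x m).lt_of_ne' hpm
  set r := (entries x).esymmMean (m + 1) / (entries x).esymmMean m with hr
  have hr0 : 0 < r := div_pos hk0 hm0
  have hle : ∀ j, weight n (m + 1) j * ((entries x).esymmMean j * (r ^ (m + 1) / r ^ j))
      ≤ weight n (m + 1) j * (entries x).esymmMean (m + 1) := fun j =>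
    mul_le_mul_of_nonneg_left (Multiset.esymmMean_div_pow_le (entries_nonneg x) hk0 j)
      (weight_nonneg hkn j)
  have hsum : (entries x).esymmMean (m + 1) = ∑ j ∈ Finset.range (n + 1),
      weight n (m + 1) j * (entries x).esymmMean (m + 1) := by
    rw [← Finset.sum_mul, sum_weight, one_mul]
  refine ⟨r, hr0, ?_, fun hlt ⟨i, j, hij⟩ => ?_⟩
  · rw [profile_eq_sum x r, hsum]
    exact Finset.sum_le_sum fun j _ => hle j
  · -- Strict log-concavity makes the term with index `m + 2` strictly smaller.
    rw [profile_eq_sum x r, hsum]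
    refine Finset.sum_lt_sum (fun j _ => hle j) ⟨m + 2, Finset.mem_range.2 (by omega), ?_⟩
    refine mul_lt_mul_of_pos_left ?_ (weight_pos hk hlt (by omega))
    have hN := Multiset.esymmMean_mul_lt_sq (entries_nonneg x)
      ⟨(x i : ℝ), by simp [entries], (x j : ℝ), by simp [entries], by exact_mod_cast hij⟩ hp
    rw [pow_succ r (m + 1), div_mul_cancel_left₀ (pow_pos hr0 _).ne', ← div_eq_mul_inv,
      div_lt_iff₀ hr0, hr, ← mul_div_assoc, lt_div_iff₀ hm0, ← sq, mul_comm]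
    exact hN

/-- The arithmetic-geometric mean inequality, for a constant tuple. -/
lemma pow_le_profile_of_const {n k : ℕ} (hk : 1 ≤ k) (hkn : k ≤ n) (x : Fin n → ℝ≥0) {a : ℝ≥0}
    (hx : ∀ i, x i = a) {y : ℝ} (hy : 0 < y) : (a : ℝ) ^ k ≤ profile k x y := by
  have hn0 : (0 : ℝ) < n := by exact_mod_cast hk.trans hkn
  have hc := natCast_div_le_one hkn
  have h := Real.geom_mean_le_arith_mean2_weighted (w₁ := (k : ℝ) / n) (w₂ := 1 - (k : ℝ) / n)
    (p₁ := a / y) (p₂ := 1) (by positivity) (by linarith) (by positivity) zero_le_one (by ring)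
  rw [Real.one_rpow, mul_one, mul_one] at h
  have h' := pow_le_pow_left₀ (by positivity) h n
  rw [← Real.rpow_natCast, ← Real.rpow_mul (by positivity), div_mul_cancel₀ _ hn0.ne',
    Real.rpow_natCast, div_pow, div_le_iff₀ (pow_pos hy k)] at h'
  refine h'.trans_eq ?_
  simp only [profile, hx, Finset.prod_const, Finset.card_univ, Fintype.card_fin]
  rw [mul_comm]
  congr 2
  ring

lemma esymmMean_entries_of_const {n k : ℕ} (hkn : k ≤ n) (x : Fin n → ℝ≥0) {a : ℝ≥0}
    (hx : ∀ i, x i = a) : (entries x).esymmMean k = (a : ℝ) ^ k := by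
  have : entries x = Multiset.replicate n (a : ℝ) := by
    rw [Multiset.eq_replicate]
    refine ⟨card_entries x, fun b hb => ?_⟩
    obtain ⟨i, -, rfl⟩ := Multiset.mem_map.1 hb
    rw [hx]
  rw [this, Multiset.esymmMean_replicate n _ hkn]

/-- For a decreasing tuple, the product of the first `i + 1` entries is the largest of the products
that make up the elementary symmetric function. -/
lemma esymmMean_entries_eq_zero_iff {n : ℕ} {x : Fin n → ℝ≥0} (hx : Antitone x) (i : Fin n) :
    (entries x).esymmMean (i + 1) = 0 ↔ x i = 0 := by
  have hch : (n.choose (i + 1) : ℝ) ≠ 0 := by exact_mod_cast (Nat.choose_pos i.2).ne'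
  rw [Multiset.esymmMean, card_entries, div_eq_zero_iff, or_iff_left hch, esymm_entries,
    NNReal.coe_eq_zero, Finset.sum_eq_zero_iff]
  constructor
  · intro h
    have h1 := h (Finset.Iic i) (Finset.mem_powersetCard.2 ⟨Finset.subset_univ _, by simp⟩)
    obtain ⟨j, hj, hj0⟩ := Finset.prod_eq_zero_iff.1 h1
    exact le_antisymm ((hx (Finset.mem_Iic.1 hj)).trans_eq hj0) zero_le
  · intro h t ht
    have hcard := (Finset.mem_powersetCard.1 ht).2
    have : ∃ j ∈ t, i ≤ j := by
      by_contra! hc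
      have := Finset.card_le_card (fun j hj => Finset.mem_Iio.2 (hc j hj) : t ⊆ Finset.Iio i)
      rw [Fin.card_Iio] at this
      omega
    obtain ⟨j, hj, hij⟩ := this
    exact Finset.prod_eq_zero hj (le_antisymm ((hx hij).trans_eq h) zero_le)

/-! ### Comparison of the two means -/

lemma hsm_le {n k : ℕ} (hk : 1 ≤ k) (hkn : k ≤ n) (x : Fin n → ℝ≥0) {y : ℝ} (hy : 0 < y) :
    hsm ((k : ℝ) / n) x ≤ ENNReal.ofReal (profile k x y ^ (1 / (k : ℝ))) := by
  rw [hsm_eq_iInf_profile hk hkn]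
  exact iInf₂_le y hy

lemma le_hsm {n k : ℕ} (hk : 1 ≤ k) (hkn : k ≤ n) (x : Fin n → ℝ≥0) {L : ℝ} (hL : 0 ≤ L)
    (h : ∀ y, 0 < y → L ≤ profile k x y) :
    ENNReal.ofReal (L ^ (1 / (k : ℝ))) ≤ hsm ((k : ℝ) / n) x := by
  rw [hsm_eq_iInf_profile hk hkn]
  exact le_iInf₂ fun y hy =>
    ENNReal.ofReal_le_ofReal (Real.rpow_le_rpow hL (h y hy) (by positivity))

/-- If at most `k` entries are nonzero, the profile tends to its `k`-th term as `y` tends to `0`. -/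
lemma hsm_le_of_esymmMean_succ_eq_zero {n k : ℕ} (hk : 1 ≤ k) (hkn : k ≤ n) (x : Fin n → ℝ≥0)
    (hp : (entries x).esymmMean (k + 1) = 0) :
    hsm ((k : ℝ) / n) x
      ≤ ENNReal.ofReal ((weight n k k * (entries x).esymmMean k) ^ (1 / (k : ℝ))) := by
  have hprof : ∀ y : ℝ, 0 < y → profile k x y = ∑ j ∈ Finset.range (n + 1),
      weight n k j * ((entries x).esymmMean j * y ^ (k - j)) := by
    intro y hy
    rw [profile_eq_sum x y]
    refine Finset.sum_congr rfl fun j _ => ?_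
    rcases le_or_gt j k with h | h
    · rw [pow_sub₀ y hy.ne' h, div_eq_mul_inv]
    · rw [Multiset.esymmMean_eq_zero_of_le (entries_nonneg x) h hp, zero_mul, zero_mul]
  have hcont : Continuous fun y : ℝ => ENNReal.ofReal ((∑ j ∈ Finset.range (n + 1),
      weight n k j * ((entries x).esymmMean j * y ^ (k - j))) ^ (1 / (k : ℝ))) := by
    refine ENNReal.continuous_ofReal.comp (Continuous.rpow_const (by fun_prop) fun y => ?_)
    exact Or.inr (by positivity)
  have h0 : ∑ j ∈ Finset.range (n + 1),
      weight n k j * ((entries x).esymmMean j * (0 : ℝ) ^ (k - j))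
        = weight n k k * (entries x).esymmMean k := by
    rw [Finset.sum_eq_single_of_mem k (Finset.mem_range.2 (Nat.lt_succ_of_le hkn))]
    · simp
    · intro j _ hj
      rcases lt_or_gt_of_ne hj with h | h
      · rw [zero_pow (by omega), mul_zero, mul_zero]
      · rw [Multiset.esymmMean_eq_zero_of_le (entries_nonneg x) h hp, zero_mul, mul_zero]
  have ht := (hcont.tendsto 0).mono_left (nhdsWithin_le_nhds (s := Set.Ioi (0 : ℝ)))
  rw [h0] at ht
  refine ge_of_tendsto ht ?_
  filter_upwards [self_mem_nhdsWithin] with y hy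
  rw [← hprof y hy]
  exact hsm_le hk hkn x hy

lemma hsm_le_sym {n k : ℕ} (hk : 1 ≤ k) (hkn : k ≤ n) (x : Fin n → ℝ≥0) :
    hsm ((k : ℝ) / n) x ≤ sym k x := by
  rw [coe_sym]
  by_cases hp : (entries x).esymmMean k = 0
  · have h := hsm_le_of_esymmMean_succ_eq_zero hk hkn x
      (Multiset.esymmMean_succ_eq_zero (entries_nonneg x) hp)
    rwa [hp, mul_zero, ← hp] at h
  · obtain ⟨y, hy, hle, -⟩ := exists_profile_le hk hkn x hp
    exact (hsm_le hk hkn x hy).trans (ENNReal.ofReal_le_ofReal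
      (Real.rpow_le_rpow (profile_nonneg hkn x hy) hle (by positivity)))

/-- The symmetric mean as a multiple of the lower bound for the Halász–Székely mean that the
`k`-th term of the profile gives (`weight_mul_le_hsm`). -/
lemma sym_eq_mul {n k : ℕ} (hk : 1 ≤ k) (hkn : k ≤ n) (x : Fin n → ℝ≥0) :
    (sym k x : ℝ≥0∞) = ENNReal.ofReal (weight n k k ^ (-(1 / (k : ℝ))))
      * ENNReal.ofReal ((weight n k k * (entries x).esymmMean k) ^ (1 / (k : ℝ))) := by
  have hw := weight_self_pos hk hkn
  rw [coe_sym, ← ENNReal.ofReal_mul (by positivity),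
    Real.mul_rpow hw.le (esymmMean_entries_nonneg x k), ← mul_assoc, Real.rpow_neg hw.le,
    inv_mul_cancel₀ (Real.rpow_pos_of_pos hw _).ne', one_mul]

lemma weight_mul_le_hsm {n k : ℕ} (hk : 1 ≤ k) (hkn : k ≤ n) (x : Fin n → ℝ≥0) :
    ENNReal.ofReal ((weight n k k * (entries x).esymmMean k) ^ (1 / (k : ℝ)))
      ≤ hsm ((k : ℝ) / n) x :=
  le_hsm hk hkn x (mul_nonneg (weight_nonneg hkn k) (esymmMean_entries_nonneg x k))
    fun _ hy => weight_mul_le_profile hkn x hy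

lemma sym_le_mul_hsm {n k : ℕ} (hk : 1 ≤ k) (hkn : k ≤ n) (x : Fin n → ℝ≥0) :
    (sym k x : ℝ≥0∞)
      ≤ ENNReal.ofReal (weight n k k ^ (-(1 / (k : ℝ)))) * hsm ((k : ℝ) / n) x := by
  rw [sym_eq_mul hk hkn]
  gcongr
  exact weight_mul_le_hsm hk hkn x

lemma hsm_one_eq_sym {n : ℕ} (hn : 1 ≤ n) (x : Fin n → ℝ≥0) :
    hsm ((n : ℝ) / n) x = sym n x := by
  refine le_antisymm (hsm_le_sym hn le_rfl x) ?_
  have h := sym_le_mul_hsm hn le_rfl x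
  rwa [weight_self hn, Real.one_rpow, ENNReal.ofReal_one, one_mul] at h

lemma sym_eq_mul_hsm_iff {n k : ℕ} (hk : 1 ≤ k) (hkn : k < n) (x : Fin n → ℝ≥0) :
    (sym k x : ℝ≥0∞) = ENNReal.ofReal (weight n k k ^ (-(1 / (k : ℝ)))) * hsm ((k : ℝ) / n) x
      ↔ (entries x).esymmMean (k + 1) = 0 := by
  have hw : 0 < weight n k k ^ (-(1 / (k : ℝ))) :=
    Real.rpow_pos_of_pos (weight_self_pos hk hkn.le) _
  rw [sym_eq_mul hk hkn.le,
    ENNReal.mul_right_inj (ENNReal.ofReal_pos.2 hw).ne' ENNReal.ofReal_ne_top]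
  constructor
  · intro h
    by_contra hp
    obtain ⟨L, hL, hLy⟩ := exists_lt_le_profile hk hkn x hp
    have h0 : 0 ≤ weight n k k * (entries x).esymmMean k :=
      mul_nonneg (weight_nonneg hkn.le k) (esymmMean_entries_nonneg x k)
    refine absurd (le_hsm hk hkn.le x (h0.trans hL.le) hLy) (not_le.2 ?_)
    rw [← h, ENNReal.ofReal_lt_ofReal_iff_of_nonneg (by positivity)]
    exact Real.rpow_lt_rpow h0 hL (by positivity)
  · intro hp
    exact le_antisymm (weight_mul_le_hsm hk hkn.le x)
      (hsm_le_of_esymmMean_succ_eq_zero hk hkn.le x hp)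

lemma hsm_eq_sym_iff {n k : ℕ} (hk : 1 ≤ k) (hkn : k < n) (x : Fin n → ℝ≥0) :
    hsm ((k : ℝ) / n) x = sym k x
      ↔ (∀ i j, x i = x j) ∨ (entries x).esymmMean k = 0 := by
  have hk0 : (k : ℝ) ≠ 0 := by exact_mod_cast (by omega : k ≠ 0)
  constructor
  · intro h
    by_contra! hc
    obtain ⟨hne, hp⟩ := hc
    obtain ⟨y, hy, -, hlt⟩ := exists_profile_le hk hkn.le x hp
    refine absurd (hsm_le hk hkn.le x hy) (not_le.2 ?_)
    have hnn := profile_nonneg hkn.le x hy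
    rw [h, coe_sym, ENNReal.ofReal_lt_ofReal_iff_of_nonneg (by positivity)]
    exact Real.rpow_lt_rpow hnn (hlt hkn hne) (by positivity)
  · intro h
    refine le_antisymm (hsm_le_sym hk hkn.le x) ?_
    rcases h with h | h
    · have hx : ∀ i, x i = x ⟨0, by omega⟩ := fun i => h i _
      rw [coe_sym, esymmMean_entries_of_const hkn.le x hx]
      exact le_hsm hk hkn.le x (by positivity) fun y hy =>
        pow_le_profile_of_const hk hkn.le x hx hy
    · rw [coe_sym, h, Real.zero_rpow (one_div_ne_zero hk0), ENNReal.ofReal_zero]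
      exact zero_le

end HalaszSzekely

theorem theorem3p2 (n k : ℕ) (hk : 1 ≤ k) (hkn : k ≤ n) (x : Fin n → ℝ≥0) :
    (HalaszSzekely.hsm ((k : ℝ) / (n : ℝ)) x ≤ (HalaszSzekely.sym k x : ℝ≥0∞) ∧
      (HalaszSzekely.sym k x : ℝ≥0∞) ≤
        ENNReal.ofReal
            ((n.choose k : ℝ) ^ (-(1 / (k : ℝ))) / HalaszSzekely.B ((k : ℝ) / (n : ℝ))) *
          HalaszSzekely.hsm ((k : ℝ) / (n : ℝ)) x) ∧
    (Antitone x →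
      ((HalaszSzekely.sym k x : ℝ≥0∞) =
          ENNReal.ofReal
              ((n.choose k : ℝ) ^ (-(1 / (k : ℝ))) / HalaszSzekely.B ((k : ℝ) / (n : ℝ))) *
            HalaszSzekely.hsm ((k : ℝ) / (n : ℝ)) x ↔
        (∃ h : k < n, x ⟨k, h⟩ = 0) ∨ k = n) ∧
      (HalaszSzekely.hsm ((k : ℝ) / (n : ℝ)) x = (HalaszSzekely.sym k x : ℝ≥0∞) ↔
        k = n ∨ (∀ i j : Fin n, x i = x j) ∨
          x ⟨k - 1, lt_of_lt_of_le (Nat.sub_lt hk Nat.one_pos) hkn⟩ = 0)) := by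
  rw [HalaszSzekely.choose_rpow_div_B hk hkn]
  refine ⟨⟨HalaszSzekely.hsm_le_sym hk hkn x, HalaszSzekely.sym_le_mul_hsm hk hkn x⟩,
    fun hx => ?_⟩
  rcases hkn.lt_or_eq with h | rfl
  · have h1 := HalaszSzekely.esymmMean_entries_eq_zero_iff hx ⟨k, h⟩
    have h2 := HalaszSzekely.esymmMean_entries_eq_zero_iff hx
      ⟨k - 1, lt_of_lt_of_le (Nat.sub_lt hk Nat.one_pos) hkn⟩
    simp only [Nat.sub_add_cancel hk] at h2
    rw [HalaszSzekely.sym_eq_mul_hsm_iff hk h, HalaszSzekely.hsm_eq_sym_iff hk h, h2]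
    simp only [h1, h, h.ne, exists_true_left, or_false, false_or, and_self]
  · have he := HalaszSzekely.hsm_one_eq_sym hk x
    rw [HalaszSzekely.weight_self hk, Real.one_rpow, ENNReal.ofReal_one, one_mul]
    simp [he]
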